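/- Let $\mathcal{X}$ be a finite set with $|\mathcal{X}|\ge 2$, let $\mathcal{N}\colon\mathcal{X}\to 2^{\mathcal{X}}$ be a neighbourhood relation with $x\notin\mathcal{N}(x)$, with $x\in\mathcal{N}(x')$ whenever $x'\in\mathcal{N}(x)$, and such that $(\mathcal{X},\mathcal{N})$ is connected, and let $\pi$ be a probability distribution on $\mathcal{X}$ with $\pi(x)>0$ for all $x$. Put $M=\max_{x}|\mathcal{N}(x)|$, $\pi_{\min}=\min_x\pi(x)$, let $x^*$ be a mode of $\pi$ (a maximizer, fixed arbitrarily if it is not unique), and $$R=\min_{x\neq x^*}\ \max_{y\in\mathcal{N}(x)}\frac{\pi(y)}{\pi(x)}.$$ For $\ell<L$ let $h(u)=\mathrm{clip}(u,\ell,L)$, which equals $\ell$ if $u<\ell$, $u$ if $\ell\le u\le L$, and $L$ if $u>L$. Let $\mathsf{K}_h(x,x')=h(\pi(x')/\pi(x))/Z_h(x)$ for $x'\in\mathcal{N}(x)$ and $\mathsf{K}_h(x,x')=0$ otherwise, where $Z_h(x)=\sum_{\tilde x\in\mathcal{N}(x)}h(\pi(\tilde x)/\pi(x))$. Let $\mathsf{P}_h$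 be the Metropolis--Hastings transition matrix with proposal $\mathsf{K}_h$ and target $\pi$: for $x'\ne x$, $$\mathsf{P}_h(x,x')=\mathsf{K}_h(x,x')\min\Big\{1,\frac{\pi(x')\mathsf{K}_h(x',x)}{\pi(x)\mathsf{K}_h(x,x')}\Big\}\ \text{ if } x'\in\mathcal{N}(x),\qquad \mathsf{P}_h(x,x')=0\ \text{ if } x'\notin\mathcal{N}(x),$$ and $\mathsf{P}_h(x,x)=1-\sum_{\tilde x\ne x}\mathsf{P}_h(x,\tilde x)$. Let $\mathsf{P}^{\rm lazy}_h=(\mathsf{P}_h+\mathsf{I})/2$. For a transition matrix $\mathsf{P}$ with real eigenvalues $1=\lambda_1\ge\lambda_2\ge\dots\ge\lambda_{|\mathcal{X}|}$ let $\mathrm{Gap}(\mathsf{P})=1-\max\{\lambda_2,|\lambda_{|\mathcal{X}|}|\}$, and let $\tau(\mathsf{P},\epsilon)=\max_{x}\min\{t\in\mathbb{N}:\|\mathsf{P}^t(x,\cdot)-\pi\|_{\mathrm{TV}}\le\epsilon\}$, where $\|\zeta-\pi\|_{\mathrm{TV}}=\sup_{A\subset\mathcal{X}}|\zeta(A)-\pi(A)|$.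 Assume $R>M^2$, and choose $\ell=M$ and $M^2<L\le R$. Then $\mathrm{Gap}(\mathsf{P}^{\rm lazy}_h)>0$ and the relaxation time satisfies $$\mathrm{Gap}(\mathsf{P}^{\rm lazy}_h)^{-1}\le 2c(L/M^2),$$ and for every $\epsilon\in(0,1/2)$ the mixing time is finite and satisfies $$\tau(\mathsf{P}^{\rm lazy}_h,\epsilon)\le 2c(L/M^2)\,\log\Big\{\frac{1}{\epsilon\,\pi_{\min}}\Big\},$$ where $c(\rho)=4(1-\rho^{-1/2})^{-3}$. -/

import Mathlib

noncomputable section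

namespace InformedMH

variable {X : Type*} [Fintype X] [DecidableEq X]

/-- The parameter `R = min_{x ≠ x*} max_{y ∈ N(x)} π(y) / π(x)`. The neighbourhood relation is the
simple graph `G`, that is `N(x) = {y | G.Adj x y}`. -/
def tailRatio (G : SimpleGraph X) (π : X → ℝ) (xstar : X) : ℝ :=
  ⨅ x : {x : X // x ≠ xstar}, ⨆ y : G.neighborSet x, π y / π x

/-- The clipping function `u ↦ clip(u, l, L)`. -/
def clip (l L u : ℝ) : ℝ :=
  if u < l then l else if u ≤ L then u else L

section Chain

variable (G : SimpleGraph X) [DecidableRel G.Adj] (π : X → ℝ) (h : ℝ → ℝ)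

/-- The normalizing constant `Z_h(x) = ∑_{y ∈ N(x)} h(π(y) / π(x))`. -/
def normConst (x : X) : ℝ :=
  ∑ y ∈ G.neighborFinset x, h (π y / π x)

/-- The informed proposal `K_h(x, y)`, proportional to `h(π(y) / π(x))` on `N(x)`. -/
def proposal (x y : X) : ℝ :=
  if G.Adj x y then h (π y / π x) / normConst G π h x else 0

/-- The probability of proposing a move from `x` to `y` and accepting it. -/
def moveProb (x y : X) : ℝ :=
  proposal G π h x y *
    min 1 (π y * proposal G π h y x / (π x * proposal G π h x y))

/-- The transition matrix `P_h` of the informed Metropolis-Hastings chain. -/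
def transition : Matrix X X ℝ := fun x y =>
  if y = x then 1 - ∑ z ∈ Finset.univ.erase x, moveProb G π h x z
  else moveProb G π h x y

end Chain

/-- The lazy version `(P + I) / 2` of a transition matrix. -/
def lazyVersion (P : Matrix X X ℝ) : Matrix X X ℝ :=
  (1 / 2 : ℝ) • (P + 1)

/-- The transition matrix of the lazy informed Metropolis-Hastings chain with weighting function
`h = clip(·, l, L)`. -/
def lazyInformed (G : SimpleGraph X) [DecidableRel G.Adj] (π : X → ℝ) (l L : ℝ) : Matrix X X ℝ :=
  lazyVersion (transition G π (clip l L))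

/-- `eigenvalue P k` is the `k`-th largest real eigenvalue `λ_k` of `P` (`k = 1, 2, …`), counted
with algebraic multiplicity. -/
def eigenvalue (P : Matrix X X ℝ) (k : ℕ) : ℝ :=
  (P.charpoly.roots.sort (· ≥ ·)).getD (k - 1) 0

/-- `Gap(P) = 1 - max {λ_2, |λ_{|X|}|}`. -/
def spectralGap (P : Matrix X X ℝ) : ℝ :=
  1 - max (eigenvalue P 2) |eigenvalue P (Fintype.card X)|

/-- The total variation distance `sup_A |ζ(A) - π(A)|`. -/
def tvDist (ζ π : X → ℝ) : ℝ :=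
  ⨆ A : Finset X, |∑ x ∈ A, ζ x - ∑ x ∈ A, π x|

/-- `τ_x(P, ε) = min {t | ‖P^t(x, ·) - π‖_TV ≤ ε}`, equal to `⊤` if there is no such `t`. -/
def mixingTimeFrom (P : Matrix X X ℝ) (π : X → ℝ) (ε : ℝ) (x : X) : ℕ∞ :=
  ⨅ t : {t : ℕ // tvDist ((P ^ t) x) π ≤ ε}, ((t : ℕ) : ℕ∞)

/-- The mixing time `τ(P, ε) = max_x τ_x(P, ε)`. -/
def mixingTime (P : Matrix X X ℝ) (π : X → ℝ) (ε : ℝ) : ℕ∞ :=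
  ⨆ x : X, mixingTimeFrom P π ε x

/-- The constant `c(ρ) = 4 / (1 - ρ^{-1/2})^3`. -/
def mixConst (ρ : ℝ) : ℝ :=
  4 / (1 - ρ ^ (-(1 / 2) : ℝ)) ^ 3

end InformedMH

end

/-! The proof is a Dirichlet-form comparison with an auxiliary uphill kernel `Q`, in place of
canonical paths. Away from the mode, `Q` is the informed proposal conditioned on neighbours with `π
y / π x ≥ M`. Two facts carry the argument.

`Q` is dominated by the chain: `Q ≤ 2 P_h` off the diagonal (`uphillKernel_le`). Uphill proposals
are always accepted, and some neighbour has ratio at least `L`. So the uphill weights sum to at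
least `L`, while all the others together contribute at most `M ^ 2 < L`.

`Q` expands `π`: since it only climbs, `π Q ≤ (M / L) π ≤ θ ^ 2 π` with `θ = (L / M ^ 2) ^ (-1/2)`
(`sum_mul_uphillKernel_le`). For `g` vanishing at the mode, Minkowski's inequality suggests `‖g‖ ≤
𝓔_Q(g) ^ (1/2) + θ ‖g‖`, where `𝓔_Q(g) = ∑ π(x) Q(x, y) (g x - g y) ^ 2`. Hence `(1 - θ) ^ 2 ‖g‖ ^ 2
≤ 𝓔_Q(g)` (`weightedInner_self_le_of_uphill`).

Applied to `g = f - f(x*)` with `f` of mean zero, these give a Poincaré inequality for `P_h` with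
constant `(1 - θ) ^ 2 / 4`. Laziness halves it and makes the form nonnegative, so the inequality
controls both the spectral gap and the `L²(π)` contraction behind the total variation bound. -/

namespace InformedMH

/-! ### Reversible matrices: Dirichlet form, spectrum, convergence in `L²(π)`. -/

section Reversible

variable {X : Type*} [Fintype X]

/-- The inner product of `L²(π)`. -/
def weightedInner (π f g : X → ℝ) : ℝ := ∑ x, π x * (f x * g x)

theorem weightedInner_comm (π f g : X → ℝ) : weightedInner π f g = weightedInner π g f := by
  simp only [weightedInner, mul_comm (f _)]

theorem weightedInner_add_left (π f g k : X → ℝ) :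
    weightedInner π (f + g) k = weightedInner π f k + weightedInner π g k := by
  simp only [weightedInner, ← Finset.sum_add_distrib, Pi.add_apply]
  exact Finset.sum_congr rfl fun x _ => by ring

theorem weightedInner_smul_left (π f g : X → ℝ) (c : ℝ) :
    weightedInner π (c • f) g = c * weightedInner π f g := by
  simp only [weightedInner, Finset.mul_sum, Pi.smul_apply, smul_eq_mul]
  exact Finset.sum_congr rfl fun x _ => by ring

theorem weightedInner_add_right (π f g k : X → ℝ) :
    weightedInner π k (f + g) = weightedInner π k f + weightedInner π k g := by
  rw [weightedInner_comm, weightedInner_add_left, weightedInner_comm π f, weightedInner_comm π g]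

theorem weightedInner_smul_right (π f g : X → ℝ) (c : ℝ) :
    weightedInner π f (c • g) = c * weightedInner π f g := by
  rw [weightedInner_comm, weightedInner_smul_left, weightedInner_comm]

theorem weightedInner_self_nonneg {π : X → ℝ} (hpos : ∀ x, 0 < π x) (f : X → ℝ) :
    0 ≤ weightedInner π f f :=
  Finset.sum_nonneg fun x _ => mul_nonneg (hpos x).le (mul_self_nonneg _)

theorem mul_sq_le_weightedInner_self {π : X → ℝ} (hpos : ∀ x, 0 < π x) (f : X → ℝ) (x : X) :
    π x * (f x * f x) ≤ weightedInner π f f :=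
  Finset.single_le_sum (f := fun x => π x * (f x * f x))
    (fun x _ => mul_nonneg (hpos x).le (mul_self_nonneg _)) (Finset.mem_univ x)

theorem weightedInner_mulVec (π f g : X → ℝ) (P : Matrix X X ℝ) :
    weightedInner π f (P.mulVec g) = ∑ x, ∑ y, π x * P x y * (f x * g y) := by
  simp only [weightedInner, Matrix.mulVec, dotProduct, Finset.mul_sum]
  exact Finset.sum_congr rfl fun x _ => Finset.sum_congr rfl fun y _ => by ring

variable {P : Matrix X X ℝ} {π : X → ℝ}

theorem weightedInner_mulVec_comm (hrev : ∀ x y, π x * P x y = π y * P y x) (f g : X → ℝ) :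
    weightedInner π f (P.mulVec g) = weightedInner π (P.mulVec f) g := by
  rw [weightedInner_comm π _ g, weightedInner_mulVec, weightedInner_mulVec, Finset.sum_comm]
  refine Finset.sum_congr rfl fun x _ => Finset.sum_congr rfl fun y _ => ?_
  rw [hrev]
  ring

theorem mulVec_one_of_row_sum (hrow : ∀ x, ∑ y, P x y = 1) :
    P.mulVec 1 = 1 := by
  ext x
  simp [Matrix.mulVec, dotProduct, hrow]

theorem sum_mulVec_of_reversible (hrev : ∀ x y, π x * P x y = π y * P y x)
    (hrow : ∀ x, ∑ y, P x y = 1) (f : X → ℝ) :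
    ∑ x, π x * P.mulVec f x = ∑ x, π x * f x := by
  have h := weightedInner_mulVec_comm hrev 1 f
  rw [mulVec_one_of_row_sum hrow] at h
  simpa [weightedInner] using h

theorem sum_weighted_sq_left (hrow : ∀ x, ∑ y, P x y = 1) (f : X → ℝ) :
    ∑ x, ∑ y, π x * P x y * (f x * f x) = weightedInner π f f := by
  refine Finset.sum_congr rfl fun x _ => ?_
  rw [← Finset.sum_mul, ← Finset.mul_sum, hrow, mul_one]

theorem sum_weighted_sq_right (hrev : ∀ x y, π x * P x y = π y * P y x)
    (hrow : ∀ x, ∑ y, P x y = 1) (f : X → ℝ) :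
    ∑ x, ∑ y, π x * P x y * (f y * f y) = weightedInner π f f := by
  rw [Finset.sum_comm, ← sum_weighted_sq_left hrow]
  exact Finset.sum_congr rfl fun x _ => Finset.sum_congr rfl fun y _ => by rw [hrev]

theorem sum_sq_sub_of_reversible (hrev : ∀ x y, π x * P x y = π y * P y x)
    (hrow : ∀ x, ∑ y, P x y = 1) (f : X → ℝ) :
    ∑ x, ∑ y, π x * P x y * (f x - f y) ^ 2 =
      2 * (weightedInner π f f - weightedInner π f (P.mulVec f)) := by
  have h : ∑ x, ∑ y, π x * P x y * (f x - f y) ^ 2 =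
      ∑ x, ∑ y, π x * P x y * (f x * f x) + ∑ x, ∑ y, π x * P x y * (f y * f y)
        - 2 * ∑ x, ∑ y, π x * P x y * (f x * f y) := by
    simp only [Finset.mul_sum, ← Finset.sum_add_distrib, ← Finset.sum_sub_distrib]
    exact Finset.sum_congr rfl fun x _ => Finset.sum_congr rfl fun y _ => by ring
  rw [h, sum_weighted_sq_left hrow, sum_weighted_sq_right hrev hrow, ← weightedInner_mulVec]
  ring

theorem sum_sq_add_of_reversible (hrev : ∀ x y, π x * P x y = π y * P y x)
    (hrow : ∀ x, ∑ y, P x y = 1) (f : X → ℝ) :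
    ∑ x, ∑ y, π x * P x y * (f x + f y) ^ 2 =
      2 * (weightedInner π f f + weightedInner π f (P.mulVec f)) := by
  have h : ∑ x, ∑ y, π x * P x y * (f x + f y) ^ 2 =
      ∑ x, ∑ y, π x * P x y * (f x * f x) + ∑ x, ∑ y, π x * P x y * (f y * f y)
        + 2 * ∑ x, ∑ y, π x * P x y * (f x * f y) := by
    simp only [Finset.mul_sum, ← Finset.sum_add_distrib]
    exact Finset.sum_congr rfl fun x _ => Finset.sum_congr rfl fun y _ => by ring
  rw [h, sum_weighted_sq_left hrow, sum_weighted_sq_right hrev hrow, ← weightedInner_mulVec]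
  ring

/-- Cauchy–Schwarz for the nonnegative form `⟨f, P g⟩` with `g = P f`: `⟨g, g⟩ ^ 2 ≤ ⟨f, P f⟩ ⟨g, P
g⟩ ≤ q ^ 2 ⟨f, f⟩ ⟨g, g⟩`. This turns the Poincaré inequality into a contraction without
diagonalizing `P`. -/
theorem weightedInner_mulVec_self_le_of_nonneg (hpos : ∀ x, 0 < π x) {q : ℝ} (hq : 0 < q)
    (hrev : ∀ x y, π x * P x y = π y * P y x) (hrow : ∀ x, ∑ y, P x y = 1)
    (hpsd : ∀ f, 0 ≤ weightedInner π f (P.mulVec f))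
    (hgap : ∀ f, ∑ x, π x * f x = 0 →
      weightedInner π f (P.mulVec f) ≤ q * weightedInner π f f)
    {f : X → ℝ} (hf : ∑ x, π x * f x = 0) :
    weightedInner π (P.mulVec f) (P.mulVec f) ≤ q ^ 2 * weightedInner π f f := by
  set g := P.mulVec f with hg
  have hg0 : ∑ x, π x * g x = 0 := by rw [hg, sum_mulVec_of_reversible hrev hrow, hf]
  set a := weightedInner π f f
  set b := weightedInner π g g
  have ha : 0 ≤ a := weightedInner_self_nonneg hpos f
  have hb : 0 ≤ b := weightedInner_self_nonneg hpos g
  have h1 : weightedInner π f g ≤ q * a := hgap f hf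
  have h2 : weightedInner π g (P.mulVec g) ≤ q * b := hgap g hg0
  have h3 : weightedInner π f (P.mulVec g) = b := weightedInner_mulVec_comm hrev f g
  -- The form evaluated at `g - s f`, with the two diagonal terms bounded through `hgap`.
  have key : ∀ s : ℝ, 0 ≤ q * b - 2 * s * b + s ^ 2 * (q * a) := by
    intro s
    have h := hpsd (g + (-s) • f)
    rw [Matrix.mulVec_add, Matrix.mulVec_smul, ← hg, weightedInner_add_left,
      weightedInner_add_right, weightedInner_add_right, weightedInner_smul_left,
      weightedInner_smul_left, weightedInner_smul_right, weightedInner_smul_right, h3] at h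
    change 0 ≤ weightedInner π g (P.mulVec g) + -s * b + (-s * b + -s * (-s * weightedInner π f g)) at h
    nlinarith [mul_le_mul_of_nonneg_left h1 (sq_nonneg s)]
  rcases ha.eq_or_lt with ha0 | ha0
  -- When `a = 0` the quadratic degenerates to `(q - 2 s) b`, and any `s > q / 2` forces `b ≤ 0`.
  · have h6 := key (q + 1)
    rw [← ha0] at h6 ⊢
    nlinarith
  -- The minimizer of the quadratic in `s`.
  · have h6 := key (b / (q * a))
    have h7 : q * b - 2 * (b / (q * a)) * b + (b / (q * a)) ^ 2 * (q * a)
        = (b * (q ^ 2 * a - b)) / (q * a) := by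
      field_simp
      ring
    rw [h7] at h6
    have h8 : 0 ≤ b * (q ^ 2 * a - b) := by
      by_contra! hc
      exact absurd h6 (not_le.2 (div_neg_of_neg_of_pos hc (by positivity)))
    rcases hb.eq_or_lt with hb0 | hb0
    · rw [← hb0]; positivity
    · nlinarith [nonneg_of_mul_nonneg_right h8 hb0]

variable [DecidableEq X]

/-- Conjugating `P` by the diagonal matrix of `√π` gives a symmetric matrix with the same
characteristic polynomial. Its orthonormal eigenvectors, divided by `√π`, are orthonormal in
`L²(π)`. The shift by one is between 0-based `Fin` indices and the 1-based `eigenvalue`. -/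
theorem exists_orthonormal_eigenvectors (hpos : ∀ x, 0 < π x)
    (hrev : ∀ x y, π x * P x y = π y * P y x) :
    ∃ (μ : Fin (Fintype.card X) → ℝ) (u : Fin (Fintype.card X) → X → ℝ), Antitone μ ∧
      (∀ k : Fin (Fintype.card X), eigenvalue P ((k : ℕ) + 1) = μ k) ∧ (∀ k, P.mulVec (u k) = μ k • u k) ∧
      ∀ i j, weightedInner π (u i) (u j) = if i = j then 1 else 0 := by
  have hs : ∀ x, 0 < √(π x) := fun x => Real.sqrt_pos.2 (hpos x)
  set D : Matrix X X ℝ := Matrix.diagonal fun x => √(π x)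
  set E : Matrix X X ℝ := Matrix.diagonal fun x => (√(π x))⁻¹
  have hDE : D * E = 1 := by
    simp [D, E, Matrix.diagonal_mul_diagonal, mul_inv_cancel₀ (hs _).ne']
  have hED : E * D = 1 := by
    simp [D, E, Matrix.diagonal_mul_diagonal, inv_mul_cancel₀ (hs _).ne']
  set A : Matrix X X ℝ := D * P * E with hAdef
  have hA : A.IsHermitian := by
    ext x y
    simp only [Matrix.conjTranspose_apply, star_trivial, hAdef, D, E, Matrix.mul_diagonal,
      Matrix.diagonal_mul]
    have h := hrev x y
    rw [← Real.mul_self_sqrt (hpos x).le, ← Real.mul_self_sqrt (hpos y).le] at h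
    have := (hs x).ne'
    have := (hs y).ne'
    field_simp
    linarith
  have hchar : A.charpoly = P.charpoly := by
    rw [hAdef, Matrix.charpoly_mul_comm, ← mul_assoc, hED, one_mul]
  let e : Fin (Fintype.card X) ≃ X := Fintype.equivOfCardEq (Fintype.card_fin _)
  refine ⟨hA.eigenvalues₀, fun k => E.mulVec (hA.eigenvectorBasis (e k)),
    hA.eigenvalues₀_antitone, fun k => ?_, fun k => ?_, fun i j => ?_⟩
  · have h := hA.sort_roots_charpoly_eq_eigenvalues₀
    rw [hchar] at h
    have h' : P.charpoly.roots.sort (· ≥ ·) = List.ofFn hA.eigenvalues₀ := by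
      rw [← h]; congr 1; exact (Multiset.map_id' _).symm
    rw [eigenvalue, h']
    simp
  · have h := hA.mulVec_eigenvectorBasis (e k)
    have h2 : hA.eigenvalues (e k) = hA.eigenvalues₀ k := by
      simp [Matrix.IsHermitian.eigenvalues, e]
    rw [h2] at h
    have h3 : P * E = E * A := by
      rw [hAdef, ← mul_assoc, ← mul_assoc, hED, one_mul]
    rw [Matrix.mulVec_mulVec, h3, ← Matrix.mulVec_mulVec, h, Matrix.mulVec_smul]
  · have h := orthonormal_iff_ite.1 hA.eigenvectorBasis.orthonormal (e i) (e j)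
    rw [EuclideanSpace.inner_eq_star_dotProduct] at h
    simp only [EmbeddingLike.apply_eq_iff_eq] at h
    rw [← h, weightedInner, dotProduct]
    refine Finset.sum_congr rfl fun x _ => ?_
    simp only [E, Matrix.mulVec_diagonal, star_trivial]
    have := (hs x).ne'
    nth_rw 1 [← Real.mul_self_sqrt (hpos x).le]
    field_simp

/-- A Courant–Fischer argument: the span of the first two eigenvectors meets the mean-zero
hyperplane, and there the form is at least `λ₂` times the squared norm. The leading eigenvector need
not be identified as constant. Nonnegativity of the form makes the absolute value in the gap
harmless. -/
theorem one_sub_le_spectralGap [Nontrivial X] (hpos : ∀ x, 0 < π x) {q : ℝ}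
    (hrev : ∀ x y, π x * P x y = π y * P y x)
    (hpsd : ∀ f, 0 ≤ weightedInner π f (P.mulVec f))
    (hgap : ∀ f, ∑ x, π x * f x = 0 →
      weightedInner π f (P.mulVec f) ≤ q * weightedInner π f f) :
    1 - q ≤ spectralGap P := by
  obtain ⟨μ, u, hanti, hμ, hu, horth⟩ := exists_orthonormal_eigenvectors hpos hrev
  have hcard : 1 < Fintype.card X := Fintype.one_lt_card
  let i₀ : Fin (Fintype.card X) := ⟨0, by omega⟩
  let i₁ : Fin (Fintype.card X) := ⟨1, by omega⟩
  let iₙ : Fin (Fintype.card X) := ⟨Fintype.card X - 1, by omega⟩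
  have h2 : eigenvalue P 2 = μ i₁ := hμ i₁
  have hn : eigenvalue P (Fintype.card X) = μ iₙ := by
    rw [← hμ iₙ]
    congr 1
    simp only [iₙ]
    omega
  have h01 : μ i₁ ≤ μ i₀ := hanti (Fin.mk_le_mk.2 (by omega))
  have h1n : μ iₙ ≤ μ i₁ := hanti (Fin.mk_le_mk.2 (by omega))
  have hn0 : 0 ≤ μ iₙ := by
    have h := hpsd (u iₙ)
    rwa [hu, weightedInner_smul_right, horth, if_pos rfl, mul_one] at h
  have hne : i₀ ≠ i₁ := by simp [i₀, i₁]
  have hcomb : ∀ a b : ℝ, a * ∑ x, π x * u i₀ x + b * ∑ x, π x * u i₁ x = 0 →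
      μ i₀ * a ^ 2 + μ i₁ * b ^ 2 ≤ q * (a ^ 2 + b ^ 2) := by
    intro a b hab
    have h := hgap (a • u i₀ + b • u i₁) (by
      rw [← hab, Finset.mul_sum, Finset.mul_sum, ← Finset.sum_add_distrib]
      refine Finset.sum_congr rfl fun x _ => ?_
      simp only [Pi.add_apply, Pi.smul_apply, smul_eq_mul]
      ring)
    simp only [Matrix.mulVec_add, Matrix.mulVec_smul, hu, weightedInner_add_left,
      weightedInner_add_right, weightedInner_smul_left, weightedInner_smul_right, horth,
      if_neg hne, if_neg hne.symm, if_true] at h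
    linarith
  have hq : μ i₁ ≤ q := by
    by_cases h0 : ∑ x, π x * u i₁ x = 0
    · simpa using hcomb 0 1 (by simp [h0])
    -- These coefficients make the combination mean-zero, and they are not both zero in this case.
    · have h := hcomb (∑ x, π x * u i₁ x) (-∑ x, π x * u i₀ x) (by ring)
      have hp : 0 < (∑ x, π x * u i₁ x) ^ 2 + (-∑ x, π x * u i₀ x) ^ 2 := by positivity
      refine le_of_mul_le_mul_right (le_trans ?_ h) hp
      nlinarith [mul_le_mul_of_nonneg_right h01 (sq_nonneg (∑ x, π x * u i₁ x))]
  rw [spectralGap, h2, hn, abs_of_nonneg hn0, max_eq_left h1n]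
  linarith

theorem weightedInner_pow_mulVec_le (hpos : ∀ x, 0 < π x) {q : ℝ} (hq : 0 < q)
    (hrev : ∀ x y, π x * P x y = π y * P y x) (hrow : ∀ x, ∑ y, P x y = 1)
    (hpsd : ∀ f, 0 ≤ weightedInner π f (P.mulVec f))
    (hgap : ∀ f, ∑ x, π x * f x = 0 →
      weightedInner π f (P.mulVec f) ≤ q * weightedInner π f f)
    (t : ℕ) {f : X → ℝ} (hf : ∑ x, π x * f x = 0) :
    ∑ x, π x * (P ^ t).mulVec f x = 0 ∧
    weightedInner π ((P ^ t).mulVec f) ((P ^ t).mulVec f) ≤ (q ^ t) ^ 2 * weightedInner π f f := by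
  induction t with
  | zero => simp [hf]
  | succ t ih =>
    rw [pow_succ' P, ← Matrix.mulVec_mulVec]
    refine ⟨by rw [sum_mulVec_of_reversible hrev hrow, ih.1], ?_⟩
    have h := weightedInner_mulVec_self_le_of_nonneg hpos hq hrev hrow hpsd hgap ih.1
    have h2 := mul_le_mul_of_nonneg_left ih.2 (sq_nonneg q)
    calc _ ≤ _ := h
      _ ≤ _ := h2
      _ = _ := by ring

theorem tvDist_pow_le (hpos : ∀ x, 0 < π x) (hsum : ∑ x, π x = 1) {q : ℝ} (hq : 0 < q)
    (hrev : ∀ x y, π x * P x y = π y * P y x) (hrow : ∀ x, ∑ y, P x y = 1)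
    (hpsd : ∀ f, 0 ≤ weightedInner π f (P.mulVec f))
    (hgap : ∀ f, ∑ x, π x * f x = 0 →
      weightedInner π f (P.mulVec f) ≤ q * weightedInner π f f) (t : ℕ) (x : X) :
    tvDist ((P ^ t) x) π ≤ q ^ t / (2 * √(π x)) := by
  refine ciSup_le fun A => ?_
  set p := ∑ y ∈ A, π y with hp
  -- For the centred indicator of `A`, `(P ^ t f)(x)` is exactly `P ^ t (x, A) - π(A)`; its squared
  -- norm is the variance `p (1 - p) ≤ 1 / 4`, the source of the factor `1 / 2`.
  set f : X → ℝ := fun y => (if y ∈ A then 1 else 0) - p with hfdef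
  have hf : ∑ y, π y * f y = 0 := by
    simp [hfdef, mul_sub, Finset.sum_sub_distrib, ← Finset.sum_mul, hsum, hp]
  have hff : weightedInner π f f ≤ 1 / 4 := by
    have h1 : weightedInner π f f = ∑ y, π y * (if y ∈ A then 1 - 2 * p else 0)
        + (∑ y, π y) * p ^ 2 := by
      rw [Finset.sum_mul, ← Finset.sum_add_distrib, weightedInner]
      refine Finset.sum_congr rfl fun y _ => ?_
      by_cases hy : y ∈ A <;> simp only [hfdef, hy, if_true, if_false] <;> ring
    have h2 : ∑ y, π y * (if y ∈ A then 1 - 2 * p else 0) = p * (1 - 2 * p) := by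
      simp [hp, Finset.sum_mul]
    rw [h1, h2, hsum]
    nlinarith [sq_nonneg (p - 1 / 2)]
  have hrowt : (P ^ t).mulVec 1 = 1 := by
    clear * - hrow
    induction t with
    | zero => simp
    | succ t ih => rw [pow_succ, ← Matrix.mulVec_mulVec, mulVec_one_of_row_sum hrow, ih]
  have hval : (P ^ t).mulVec f x = ∑ y ∈ A, (P ^ t) x y - p := by
    have h1 : f = (fun y => if y ∈ A then 1 else 0) - p • (1 : X → ℝ) := by
      ext y; simp [hfdef]
    rw [h1, Matrix.mulVec_sub, Matrix.mulVec_smul, hrowt]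
    simp [Matrix.mulVec, dotProduct]
  rw [← hval]
  have h := (weightedInner_pow_mulVec_le hpos hq hrev hrow hpsd hgap t hf).2
  have h3 := (mul_sq_le_weightedInner_self hpos ((P ^ t).mulVec f) x).trans h
  have hs := Real.sqrt_pos.2 (hpos x)
  rw [le_div_iff₀ (by positivity)]
  refine abs_le_of_sq_le_sq' ?_ (by positivity) |>.2
  rw [mul_pow, sq_abs, mul_pow, Real.sq_sqrt (hpos x).le]
  nlinarith [mul_le_mul_of_nonneg_left hff (sq_nonneg (q ^ t))]

end Reversible

end InformedMH

/-! ### Clipping and the Metropolis–Hastings chain. -/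

namespace InformedMH

theorem clip_eq_min_max {l L : ℝ} (h : l ≤ L) (u : ℝ) : clip l L u = min L (max l u) := by
  unfold clip
  split_ifs with h1 h2
  · rw [max_eq_left h1.le, min_eq_right h]
  · rw [max_eq_right (not_lt.1 h1), min_eq_right h2]
  · rw [max_eq_right (not_lt.1 h1), min_eq_left (not_le.1 h2).le]

theorem le_clip {l L : ℝ} (h : l ≤ L) (u : ℝ) : l ≤ clip l L u := by
  rw [clip_eq_min_max h]
  exact le_min h (le_max_left _ _)

theorem clip_le {l L : ℝ} (h : l ≤ L) (u : ℝ) : clip l L u ≤ L := by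
  rw [clip_eq_min_max h]
  exact min_le_left _ _

theorem clip_le_self {l L u : ℝ} (h : l ≤ L) (hu : l ≤ u) : clip l L u ≤ u := by
  rw [clip_eq_min_max h, max_eq_right hu]
  exact min_le_right _ _

theorem clip_of_le {l L u : ℝ} (h : l ≤ L) (hu : L ≤ u) : clip l L u = L := by
  rw [clip_eq_min_max h, max_eq_right (h.trans hu), min_eq_left hu]

theorem clip_of_ge {l L u : ℝ} (h : l ≤ L) (hu : u ≤ l) : clip l L u = l := by
  rw [clip_eq_min_max h, max_eq_left hu, min_eq_right h]

section Chain

variable {X : Type*} [Fintype X] {G : SimpleGraph X} [DecidableRel G.Adj]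
  {π : X → ℝ} {h : ℝ → ℝ}

theorem normConst_nonneg (hh : ∀ u, 0 < h u) (x : X) : 0 ≤ normConst G π h x :=
  Finset.sum_nonneg fun _ _ => (hh _).le

theorem normConst_pos (hh : ∀ u, 0 < h u) {x y : X} (hxy : G.Adj x y) : 0 < normConst G π h x :=
  Finset.sum_pos (fun _ _ => hh _) ⟨y, (G.mem_neighborFinset x y).2 hxy⟩

theorem proposal_nonneg (hh : ∀ u, 0 < h u) (x y : X) : 0 ≤ proposal G π h x y := by
  unfold proposal
  split_ifs
  · exact div_nonneg (hh _).le (normConst_nonneg hh x)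
  · exact le_rfl

theorem proposal_pos (hh : ∀ u, 0 < h u) {x y : X} (hxy : G.Adj x y) :
    0 < proposal G π h x y := by
  rw [proposal, if_pos hxy]
  exact div_pos (hh _) (normConst_pos hh hxy)

theorem sum_proposal_le_one (x : X) : ∑ y, proposal G π h x y ≤ 1 := by
  have h1 : ∑ y, proposal G π h x y = normConst G π h x / normConst G π h x := by
    conv_rhs => rw [normConst, Finset.sum_div]
    simp only [proposal, ← Finset.sum_filter]
    refine Finset.sum_congr ?_ fun _ _ => rfl
    ext y
    simp
  rw [h1]
  exact div_self_le_one _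

theorem moveProb_nonneg (hpos : ∀ x, 0 < π x) (hh : ∀ u, 0 < h u) (x y : X) :
    0 ≤ moveProb G π h x y := by
  have hxy := proposal_nonneg (G := G) (π := π) hh x y
  have hyx := proposal_nonneg (G := G) (π := π) hh y x
  have := hpos x
  have := hpos y
  unfold moveProb
  positivity

theorem moveProb_le_proposal (hh : ∀ u, 0 < h u) (x y : X) :
    moveProb G π h x y ≤ proposal G π h x y :=
  mul_le_of_le_one_right (proposal_nonneg hh x y) (min_le_left _ _)

/-- The symmetric form of the flow, from which reversibility is immediate and acceptance of a move
becomes a comparison of two flows. -/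
theorem mul_moveProb (hpos : ∀ x, 0 < π x) (hh : ∀ u, 0 < h u) (x y : X) :
    π x * moveProb G π h x y = min (π x * proposal G π h x y) (π y * proposal G π h y x) := by
  by_cases hxy : G.Adj x y
  · have h1 : 0 < π x * proposal G π h x y := mul_pos (hpos x) (proposal_pos hh hxy)
    rw [moveProb, ← mul_assoc, mul_min_of_nonneg _ _ h1.le, mul_one, mul_div_cancel₀ _ h1.ne']
  · have hyx : ¬ G.Adj y x := fun h => hxy h.symm
    simp [moveProb, proposal, hxy, hyx]

variable [DecidableEq X]

theorem transition_reversible (hpos : ∀ x, 0 < π x) (hh : ∀ u, 0 < h u) (x y : X) :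
    π x * transition G π h x y = π y * transition G π h y x := by
  rcases eq_or_ne y x with rfl | hne
  · rfl
  · rw [transition, transition, if_neg hne, if_neg hne.symm, mul_moveProb hpos hh,
      mul_moveProb hpos hh, min_comm]

theorem sum_transition (x : X) : ∑ y, transition G π h x y = 1 := by
  rw [← Finset.add_sum_erase _ _ (Finset.mem_univ x)]
  have h1 : ∑ y ∈ Finset.univ.erase x, transition G π h x y
      = ∑ y ∈ Finset.univ.erase x, moveProb G π h x y :=
    Finset.sum_congr rfl fun y hy => by rw [transition, if_neg (Finset.ne_of_mem_erase hy)]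
  rw [h1, transition, if_pos rfl]
  ring

theorem transition_nonneg (hpos : ∀ x, 0 < π x) (hh : ∀ u, 0 < h u) (x y : X) :
    0 ≤ transition G π h x y := by
  unfold transition
  split_ifs with hy
  · have h1 : ∑ z ∈ Finset.univ.erase x, moveProb G π h x z ≤ ∑ z, proposal G π h x z :=
      (Finset.sum_le_sum fun z _ => moveProb_le_proposal hh x z).trans
        (Finset.sum_le_univ_sum_of_nonneg fun z => proposal_nonneg hh x z)
    linarith [sum_proposal_le_one (G := G) (π := π) (h := h) x]
  · exact moveProb_nonneg hpos hh x y

end Chain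

/-! ### The lazy chain. -/

section Lazy

variable {X : Type*} [DecidableEq X] {P : Matrix X X ℝ} {π : X → ℝ}

theorem lazyVersion_reversible (hrev : ∀ x y, π x * P x y = π y * P y x) (x y : X) :
    π x * lazyVersion P x y = π y * lazyVersion P y x := by
  simp only [lazyVersion, Matrix.smul_apply, Matrix.add_apply, smul_eq_mul]
  rcases eq_or_ne x y with rfl | hne
  · rfl
  · rw [Matrix.one_apply_ne hne, Matrix.one_apply_ne hne.symm]
    linarith [hrev x y]

variable [Fintype X]

theorem sum_lazyVersion (hrow : ∀ x, ∑ y, P x y = 1) (x : X) : ∑ y, lazyVersion P x y = 1 := by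
  simp only [lazyVersion, Matrix.smul_apply, Matrix.add_apply, smul_eq_mul, ← Finset.mul_sum,
    Finset.sum_add_distrib, hrow, Matrix.one_apply, Finset.sum_ite_eq, Finset.mem_univ, if_true]
  norm_num

theorem weightedInner_lazyVersion (f : X → ℝ) :
    weightedInner π f ((lazyVersion P).mulVec f) =
      (weightedInner π f (P.mulVec f) + weightedInner π f f) / 2 := by
  rw [lazyVersion, Matrix.smul_mulVec, Matrix.add_mulVec, Matrix.one_mulVec,
    weightedInner_smul_right, weightedInner_add_right]
  ring

theorem weightedInner_lazyVersion_nonneg (hpos : ∀ x, 0 < π x) (hnn : ∀ x y, 0 ≤ P x y)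
    (hrev : ∀ x y, π x * P x y = π y * P y x) (hrow : ∀ x, ∑ y, P x y = 1) (f : X → ℝ) :
    0 ≤ weightedInner π f ((lazyVersion P).mulVec f) := by
  have h := sum_sq_add_of_reversible hrev hrow f
  have h2 : 0 ≤ ∑ x, ∑ y, π x * P x y * (f x + f y) ^ 2 :=
    Finset.sum_nonneg fun x _ => Finset.sum_nonneg fun y _ =>
      mul_nonneg (mul_nonneg (hpos x).le (hnn x y)) (sq_nonneg _)
  rw [weightedInner_lazyVersion]
  linarith

end Lazy

/-! ### The Poincaré inequality for an expanding kernel. -/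

section Poincare

variable {X : Type*} [Fintype X] {π : X → ℝ}

/-- A Poincaré-type inequality for a kernel `Q` which moves every state but `z` and expands `π`
by a factor of at least `θ⁻²`. -/
theorem weightedInner_self_le_of_uphill (hpos : ∀ x, 0 < π x) {Q : X → X → ℝ}
    (hQ : ∀ x y, 0 ≤ Q x y) {z : X} (hQsum : ∀ x, x ≠ z → ∑ y, Q x y = 1)
    {θ : ℝ} (hθ : 0 < θ) (hθ1 : θ < 1) (hexp : ∀ y, ∑ x, π x * Q x y ≤ θ ^ 2 * π y)
    {g : X → ℝ} (hg : g z = 0) :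
    (1 - θ) ^ 2 * weightedInner π g g ≤ ∑ x, ∑ y, π x * Q x y * (g x - g y) ^ 2 := by
  have h1θ : 0 < 1 - θ := by linarith
  -- Minkowski in pointwise form: `a ^ 2 ≤ (a - b) ^ 2 / (1 - θ) + b ^ 2 / θ`, with weights chosen
  -- so that the `b` term sums to at most `θ ‖g‖ ^ 2`.
  have hpt : ∀ a b : ℝ, θ * (1 - θ) * (a * a) ≤ θ * (a - b) ^ 2 + (1 - θ) * (b * b) := by
    intro a b
    nlinarith [sq_nonneg (θ * a - b)]
  have hleft : weightedInner π g g ≤ ∑ x, ∑ y, π x * Q x y * (g x * g x) := by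
    refine Finset.sum_le_sum fun x _ => ?_
    rw [← Finset.sum_mul, ← Finset.mul_sum]
    rcases eq_or_ne x z with rfl | hx
    · simp [hg]
    · rw [hQsum x hx, mul_one]
  have hright : ∑ x, ∑ y, π x * Q x y * (g y * g y) ≤ θ ^ 2 * weightedInner π g g := by
    rw [Finset.sum_comm, weightedInner, Finset.mul_sum]
    refine Finset.sum_le_sum fun y _ => ?_
    rw [← Finset.sum_mul, ← mul_assoc (θ ^ 2)]
    exact mul_le_mul_of_nonneg_right (hexp y) (mul_self_nonneg _)
  have hmid : θ * (1 - θ) * ∑ x, ∑ y, π x * Q x y * (g x * g x) ≤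
      θ * ∑ x, ∑ y, π x * Q x y * (g x - g y) ^ 2
        + (1 - θ) * ∑ x, ∑ y, π x * Q x y * (g y * g y) := by
    simp only [Finset.mul_sum, ← Finset.sum_add_distrib]
    refine Finset.sum_le_sum fun x _ => Finset.sum_le_sum fun y _ => ?_
    nlinarith [mul_le_mul_of_nonneg_left (hpt (g x) (g y)) (mul_nonneg (hpos x).le (hQ x y))]
  refine le_of_mul_le_mul_left ?_ hθ
  nlinarith [mul_le_mul_of_nonneg_left hleft (mul_pos hθ h1θ).le,
    mul_le_mul_of_nonneg_left hright h1θ.le]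

end Poincare

end InformedMH

namespace InformedMH

/-! ### The uphill kernel and its comparison with the informed chain. -/

section Informed

variable {X : Type*} [Fintype X] {G : SimpleGraph X} {π : X → ℝ}

theorem exists_adj_le_ratio [Nontrivial X] (hG : G.Connected) {z : X} {L : ℝ}
    (hL : L ≤ tailRatio G π z) {x : X} (hx : x ≠ z) : ∃ y, G.Adj x y ∧ L ≤ π y / π x := by
  have h1 : L ≤ ⨆ y : G.neighborSet x, π y / π x :=
    hL.trans (ciInf_le (Set.finite_range
      (fun x : {x : X // x ≠ z} => ⨆ y : G.neighborSet x, π y / π x)).bddBelow ⟨x, hx⟩)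
  obtain ⟨w, hw⟩ := hG.preconnected.exists_adj_of_nontrivial x
  -- Without a neighbour the supremum would be the default `0` and would not be attained.
  have : Nonempty (G.neighborSet x) := ⟨⟨w, hw⟩⟩
  obtain ⟨y, hy⟩ := exists_eq_ciSup_of_finite (f := fun y : G.neighborSet x => π y / π x)
  exact ⟨y, y.2, h1.trans hy.ge⟩

variable [DecidableRel G.Adj]

/-- The total weight of the neighbours `y` of `x` with `l ≤ π y / π x`. -/
noncomputable def uphillWeight (G : SimpleGraph X) [DecidableRel G.Adj] (π : X → ℝ) (h : ℝ → ℝ) (l : ℝ)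
    (x : X) : ℝ :=
  ∑ y ∈ G.neighborFinset x with l ≤ π y / π x, h (π y / π x)

open Classical in
/-- The informed proposal away from `z`, conditioned on moving to a neighbour `y` of `x` with
`l ≤ π y / π x`. -/
noncomputable def uphillKernel (G : SimpleGraph X) [DecidableRel G.Adj] (π : X → ℝ) (h : ℝ → ℝ) (l : ℝ)
    (z x y : X) : ℝ :=
  if x ≠ z ∧ G.Adj x y ∧ l ≤ π y / π x then h (π y / π x) / uphillWeight G π h l x else 0

variable {l L : ℝ}

theorem le_uphillWeight (hl : 0 < l) (hlL : l ≤ L) {x y : X} (hxy : G.Adj x y)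
    (hy : L ≤ π y / π x) : L ≤ uphillWeight G π (clip l L) l x := by
  have hmem : y ∈ {y ∈ G.neighborFinset x | l ≤ π y / π x} :=
    Finset.mem_filter.2 ⟨(G.mem_neighborFinset x y).2 hxy, hlL.trans hy⟩
  have h := Finset.single_le_sum (f := fun y => clip l L (π y / π x))
    (fun _ _ => hl.le.trans (le_clip hlL _)) hmem
  rwa [clip_of_le hlL hy] at h

/-- Each non-uphill neighbour has clipped weight exactly `l`, and there are at most `l` of them. -/
theorem normConst_le_uphillWeight_add (hl : 0 < l) (hlL : l ≤ L) (hdeg : (G.maxDegree : ℝ) ≤ l)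
    (x : X) : normConst G π (clip l L) x ≤ uphillWeight G π (clip l L) l x + l ^ 2 := by
  rw [normConst, ← Finset.sum_filter_add_sum_filter_not _ (fun y => l ≤ π y / π x), uphillWeight,
    add_le_add_iff_left]
  have h1 : ∑ y ∈ G.neighborFinset x with ¬ l ≤ π y / π x, clip l L (π y / π x)
      = ∑ y ∈ G.neighborFinset x with ¬ l ≤ π y / π x, l :=
    Finset.sum_congr rfl fun y hy => clip_of_ge hlL (not_le.1 (Finset.mem_filter.1 hy).2).le
  rw [h1, Finset.sum_const, nsmul_eq_mul, sq]
  refine mul_le_mul_of_nonneg_right (le_trans ?_ hdeg) hl.le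
  exact_mod_cast (Finset.card_filter_le _ _).trans (G.degree_le_maxDegree x)

theorem normConst_le (hlL : l ≤ L) (hL : 0 < L) (hdeg : (G.maxDegree : ℝ) ≤ l) (x : X) :
    normConst G π (clip l L) x ≤ l * L := by
  refine (Finset.sum_le_card_nsmul _ _ L fun y _ => clip_le hlL _).trans ?_
  rw [nsmul_eq_mul]
  refine mul_le_mul_of_nonneg_right (le_trans ?_ hdeg) hL.le
  exact_mod_cast G.degree_le_maxDegree x

/-- Uphill proposals are never rejected. The reverse proposal has probability at least `l / (l L) =
1 / L`, and the forward flow is at most `π y / L`, because clipping does not raise a ratio above `l`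
and the normalizer is at least `L`. -/
theorem proposal_le_moveProb_of_uphill (hpos : ∀ x, 0 < π x) (hl : 1 ≤ l) (hlL : l ≤ L)
    (hdeg : (G.maxDegree : ℝ) ≤ l) {x y : X} (hxy : G.Adj x y) (hy : l ≤ π y / π x)
    (hZ : L ≤ normConst G π (clip l L) x) :
    proposal G π (clip l L) x y ≤ moveProb G π (clip l L) x y := by
  have hh : ∀ u, 0 < clip l L u := fun u => by linarith [le_clip hlL u]
  have hx0 := hpos x
  have hL0 : 0 < L := by linarith
  have hZy := normConst_pos (G := G) (π := π) hh hxy.symm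
  have hZx : 0 < normConst G π (clip l L) x := hL0.trans_le hZ
  have hyx : 1 / L ≤ proposal G π (clip l L) y x := by
    rw [proposal, if_pos hxy.symm, div_le_div_iff₀ hL0 hZy, one_mul]
    exact (normConst_le hlL hL0 hdeg y).trans
      (mul_le_mul_of_nonneg_right (le_clip hlL _) hL0.le)
  have hxy' : π x * proposal G π (clip l L) x y ≤ π y * (1 / L) := by
    rw [proposal, if_pos hxy, ← mul_div_assoc, mul_one_div]
    have h1 := clip_le_self hlL hy
    rw [le_div_iff₀ hx0] at h1
    exact div_le_div₀ (hpos y).le (by linarith) hL0 hZ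
  refine le_of_mul_le_mul_left ?_ hx0
  rw [mul_moveProb hpos hh]
  exact le_min le_rfl (hxy'.trans (mul_le_mul_of_nonneg_left hyx (hpos y).le))

theorem uphillKernel_nonneg {h : ℝ → ℝ} (hh : ∀ u, 0 < h u) (z x y : X) :
    0 ≤ uphillKernel G π h l z x y := by
  unfold uphillKernel
  split_ifs
  · exact div_nonneg (hh _).le (Finset.sum_nonneg fun _ _ => (hh _).le)
  · exact le_rfl

theorem sum_uphillKernel {h : ℝ → ℝ} {z x : X} (hx : x ≠ z) (hW : 0 < uphillWeight G π h l x) :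
    ∑ y, uphillKernel G π h l z x y = 1 := by
  classical
  have h1 : ∑ y, uphillKernel G π h l z x y = uphillWeight G π h l x / uphillWeight G π h l x := by
    conv_rhs => rw [uphillWeight, Finset.sum_div]
    simp only [uphillKernel, ← Finset.sum_filter]
    refine Finset.sum_congr ?_ fun _ _ => rfl
    ext y
    simp [hx]
  rw [h1, div_self hW.ne']

/-- Conditioning on uphill moves costs a factor at most 2, since `Z ≤ W + l ^ 2 ≤ W + L ≤ 2 W` for
the uphill weight `W`. -/
theorem uphillKernel_le (hpos : ∀ x, 0 < π x) (hl : 1 ≤ l) (hlL : l ^ 2 ≤ L)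
    (hdeg : (G.maxDegree : ℝ) ≤ l) {z : X} (hup : ∀ x, x ≠ z → ∃ y, G.Adj x y ∧ L ≤ π y / π x)
    (x y : X) : uphillKernel G π (clip l L) l z x y ≤ 2 * moveProb G π (clip l L) x y := by
  have hlL' : l ≤ L := by nlinarith
  have hh : ∀ u, 0 < clip l L u := fun u => by linarith [le_clip hlL' u]
  unfold uphillKernel
  split_ifs with hc
  · obtain ⟨hx, hxy, hy⟩ := hc
    obtain ⟨w, hxw, hw⟩ := hup x hx
    have hW := le_uphillWeight (by linarith) hlL' hxw hw
    have hZ := normConst_le_uphillWeight_add (π := π) (by linarith) hlL' hdeg x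
    have hWZ : uphillWeight G π (clip l L) l x ≤ normConst G π (clip l L) x :=
      Finset.sum_le_sum_of_subset_of_nonneg (Finset.filter_subset _ _) fun _ _ _ => (hh _).le
    have h1 := proposal_le_moveProb_of_uphill hpos hl hlL' hdeg hxy hy (hW.trans hWZ)
    refine le_trans ?_ (mul_le_mul_of_nonneg_left h1 zero_le_two)
    rw [proposal, if_pos hxy, ← mul_div_assoc, div_le_div_iff₀ (by linarith) (by linarith)]
    nlinarith [hh (π y / π x)]
  · exact mul_nonneg zero_le_two (moveProb_nonneg hpos hh x y)

/-- Each neighbour `x` sends flow at most `π y / L` into `y`: the clipped ratio is at most `π y / π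
x`, and the uphill weight is at least `L`. -/
theorem sum_mul_uphillKernel_le (hpos : ∀ x, 0 < π x) (hl : 0 < l) (hlL : l ≤ L)
    {z : X} (hup : ∀ x, x ≠ z → ∃ y, G.Adj x y ∧ L ≤ π y / π x) (y : X) :
    ∑ x, π x * uphillKernel G π (clip l L) l z x y ≤ G.maxDegree / L * π y := by
  have hL : 0 < L := hl.trans_le hlL
  have hpt : ∀ x, π x * uphillKernel G π (clip l L) l z x y ≤
      if G.Adj y x then π y / L else 0 := by
    intro x
    unfold uphillKernel
    by_cases hc : x ≠ z ∧ G.Adj x y ∧ l ≤ π y / π x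
    · obtain ⟨w, hxw, hw⟩ := hup x hc.1
      have hW := le_uphillWeight hl hlL hxw hw
      have h1 := clip_le_self hlL hc.2.2
      rw [le_div_iff₀ (hpos x)] at h1
      rw [if_pos hc, if_pos hc.2.1.symm, ← mul_div_assoc]
      exact div_le_div₀ (hpos y).le (by linarith) hL hW
    · rw [if_neg hc, mul_zero]
      split_ifs
      · exact (div_pos (hpos y) hL).le
      · exact le_rfl
  refine (Finset.sum_le_sum fun x _ => hpt x).trans ?_
  rw [← Finset.sum_filter, Finset.sum_const, nsmul_eq_mul, ← G.neighborFinset_eq_filter,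
    G.card_neighborFinset_eq_degree, div_mul_eq_mul_div, ← mul_div_assoc]
  refine div_le_div_of_nonneg_right (mul_le_mul_of_nonneg_right ?_ (hpos y).le) hL.le
  exact_mod_cast G.degree_le_maxDegree y

variable [DecidableEq X]

theorem weightedInner_self_le_transition (hpos : ∀ x, 0 < π x) (hsum : ∑ x, π x = 1)
    (hl : 1 ≤ l) (hlL : l ^ 2 ≤ L) (hdeg : (G.maxDegree : ℝ) ≤ l) {z : X}
    (hup : ∀ x, x ≠ z → ∃ y, G.Adj x y ∧ L ≤ π y / π x) {θ : ℝ} (hθ : 0 < θ) (hθ1 : θ < 1)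
    (hθL : l ^ 2 / L ≤ θ ^ 2) {f : X → ℝ} (hf : ∑ x, π x * f x = 0) :
    (1 - θ) ^ 2 * weightedInner π f f ≤ 4 *
      (weightedInner π f f - weightedInner π f ((transition G π (clip l L)).mulVec f)) := by
  have hlL' : l ≤ L := by nlinarith
  have hL : 0 < L := by linarith
  have hh : ∀ u, 0 < clip l L u := fun u => by linarith [le_clip hlL' u]
  set g : X → ℝ := fun x => f x - f z with hg
  -- A mean-zero function has the smallest norm among its translates by constants, so it may be
  -- recentred to vanish at `z`, where the uphill kernel does not move.
  have hfg : weightedInner π f f ≤ weightedInner π g g := by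
    have h1 : weightedInner π g g =
        weightedInner π f f - 2 * f z * ∑ x, π x * f x + f z ^ 2 * ∑ x, π x := by
      simp only [weightedInner, Finset.mul_sum, ← Finset.sum_add_distrib,
        ← Finset.sum_sub_distrib]
      exact Finset.sum_congr rfl fun x _ => by simp only [hg]; ring
    rw [h1, hf, hsum]
    nlinarith [sq_nonneg (f z)]
  have hQ := weightedInner_self_le_of_uphill hpos
    (Q := uphillKernel G π (clip l L) l z) (uphillKernel_nonneg hh z)
    (fun x hx => sum_uphillKernel hx (by
      obtain ⟨w, hxw, hw⟩ := hup x hx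
      exact hL.trans_le (le_uphillWeight (by linarith) hlL' hxw hw)))
    hθ hθ1 (fun y => (sum_mul_uphillKernel_le hpos (by linarith) hlL' hup y).trans (by
      refine mul_le_mul_of_nonneg_right (le_trans ?_ hθL) (hpos y).le
      exact div_le_div_of_nonneg_right (by nlinarith) hL.le))
    (g := g) (by simp [hg])
  have hP := sum_sq_sub_of_reversible (transition_reversible (G := G) hpos hh) sum_transition f
  have hQP : ∑ x, ∑ y, π x * uphillKernel G π (clip l L) l z x y * (g x - g y) ^ 2 ≤
      2 * ∑ x, ∑ y, π x * transition G π (clip l L) x y * (f x - f y) ^ 2 := by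
    simp only [Finset.mul_sum]
    refine Finset.sum_le_sum fun x _ => Finset.sum_le_sum fun y _ => ?_
    have hgf : g x - g y = f x - f y := by simp [hg]
    rw [hgf, ← mul_assoc 2]
    rcases eq_or_ne y x with rfl | hne
    · simp
    · refine mul_le_mul_of_nonneg_right ?_ (sq_nonneg _)
      rw [transition, if_neg hne]
      nlinarith [mul_le_mul_of_nonneg_left (uphillKernel_le hpos hl hlL hdeg hup x y) (hpos x).le]
  nlinarith [mul_le_mul_of_nonneg_left hfg (sq_nonneg (1 - θ))]

end Informed

/-! ### From the Poincaré inequality to the mixing time. -/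

section Mixing

variable {X : Type*} [Fintype X] [DecidableEq X] {P : Matrix X X ℝ} {π : X → ℝ}

theorem exists_mixingTime_eq_of_tvDist_le {ε : ℝ} {t : ℕ}
    (h : ∀ x, tvDist ((P ^ t) x) π ≤ ε) : ∃ T : ℕ, mixingTime P π ε = T ∧ T ≤ t := by
  have h1 : mixingTime P π ε ≤ t := iSup_le fun x =>
    iInf_le (fun t : {t : ℕ // tvDist ((P ^ t) x) π ≤ ε} => ((t : ℕ) : ℕ∞)) ⟨t, h x⟩
  obtain ⟨T, hT⟩ := ENat.ne_top_iff_exists.1 (ne_top_of_le_ne_top (ENat.natCast_ne_top t) h1)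
  rw [← hT] at h1 ⊢
  exact ⟨T, rfl, by exact_mod_cast h1⟩

theorem exp_one_div_eight_le_two : Real.exp (1 / 8) ≤ 2 := by
  have h := Real.exp_bound_div_one_sub_of_interval (x := 1 / 8) (by norm_num) (by norm_num)
  exact h.trans (by norm_num)

/-- Rounding the time down loses less than one step, hence a factor `exp (1 / C) ≤ exp (1 / 8) ≤ 2`.
It is absorbed by the `1 / 2` in `tvDist_pow_le`; this is where `8 ≤ C` is needed. -/
theorem tvDist_pow_floor_le [Nonempty X] (hpos : ∀ x, 0 < π x) (hsum : ∑ x, π x = 1) {C : ℝ}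
    (hC : 8 ≤ C) (hrev : ∀ x y, π x * P x y = π y * P y x) (hrow : ∀ x, ∑ y, P x y = 1)
    (hpsd : ∀ f, 0 ≤ weightedInner π f (P.mulVec f))
    (hgap : ∀ f, ∑ x, π x * f x = 0 →
      weightedInner π f (P.mulVec f) ≤ (1 - C⁻¹) * weightedInner π f f)
    {ε : ℝ} (hε : 0 < ε) (x : X) :
    tvDist ((P ^ ⌊C * Real.log (1 / (ε * ⨅ x, π x))⌋₊) x) π ≤ ε := by
  set m := ⨅ x, π x with hm
  have hC0 : 0 < C := by linarith
  have hCinv : C⁻¹ ≤ 1 / 8 := by rw [inv_eq_one_div]; exact one_div_le_one_div_of_le (by norm_num) hC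
  have hm0 : 0 < m := by
    obtain ⟨y, hy⟩ := exists_eq_ciInf_of_finite (f := π)
    rw [hm, ← hy]
    exact hpos y
  have hmx : m ≤ π x := ciInf_le (Set.finite_range π).bddBelow x
  have hx1 : π x ≤ 1 := hsum ▸ Finset.single_le_sum (fun y _ => (hpos y).le) (Finset.mem_univ x)
  set t := ⌊C * Real.log (1 / (ε * m))⌋₊ with ht
  have hq : 0 < 1 - C⁻¹ := by linarith
  have htlt : C * Real.log (1 / (ε * m)) < t + 1 := Nat.lt_floor_add_one _
  have hpow : (1 - C⁻¹) ^ t ≤ 2 * (ε * m) := by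
    have h1 : (1 - C⁻¹) ^ t ≤ Real.exp (-C⁻¹) ^ t :=
      pow_le_pow_left₀ hq.le (Real.one_sub_le_exp_neg _) t
    have h2 : -(t * C⁻¹) ≤ 1 / 8 + Real.log (ε * m) := by
      rw [one_div, Real.log_inv] at htlt
      have h3 : -Real.log (ε * m) < (t + 1) * C⁻¹ := by
        rw [← div_eq_mul_inv, lt_div_iff₀ hC0]
        linarith
      linarith
    calc (1 - C⁻¹) ^ t ≤ Real.exp (-C⁻¹) ^ t := h1
      _ = Real.exp (-(t * C⁻¹)) := by rw [← Real.exp_nat_mul]; congr 1; ring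
      _ ≤ Real.exp (1 / 8 + Real.log (ε * m)) := Real.exp_le_exp.2 h2
      _ = Real.exp (1 / 8) * (ε * m) := by
        rw [Real.exp_add, Real.exp_log (mul_pos hε hm0)]
      _ ≤ 2 * (ε * m) :=
        mul_le_mul_of_nonneg_right exp_one_div_eight_le_two (mul_pos hε hm0).le
  refine (tvDist_pow_le hpos hsum hq hrev hrow hpsd hgap t x).trans ?_
  have hs := Real.sqrt_pos.2 (hpos x)
  -- As `π x ≤ 1`, the `√(π x)` in the denominator is at least `m`, so a single factor `m` in `hpow`
  -- suffices.
  have hms : m ≤ √(π x) := hmx.trans (Real.le_sqrt_of_sq_le (by nlinarith [hpos x]))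
  rw [div_le_iff₀ (by positivity)]
  nlinarith [mul_le_mul_of_nonneg_left hms hε.le]

end Mixing

theorem mixConst_bounds {ρ : ℝ} (hρ : 1 < ρ) :
    0 < ρ ^ (-(1 / 2) : ℝ) ∧ ρ ^ (-(1 / 2) : ℝ) < 1 ∧ 8 ≤ 2 * mixConst ρ := by
  have h0 : 0 < ρ ^ (-(1 / 2) : ℝ) := Real.rpow_pos_of_pos (by linarith) _
  have h1 : ρ ^ (-(1 / 2) : ℝ) < 1 := Real.rpow_lt_one_of_one_lt_of_neg hρ (by norm_num)
  refine ⟨h0, h1, ?_⟩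
  have h2 : (1 - ρ ^ (-(1 / 2) : ℝ)) ^ 3 ≤ 1 := pow_le_one₀ (by linarith) (by linarith)
  have h3 : 0 < (1 - ρ ^ (-(1 / 2) : ℝ)) ^ 3 := pow_pos (by linarith) 3
  rw [mixConst]
  have : 4 ≤ 4 / (1 - ρ ^ (-(1 / 2) : ℝ)) ^ 3 := by
    rw [le_div_iff₀ h3]
    linarith
  linarith

theorem one_le_maxDegree {X : Type*} [Fintype X] [Nontrivial X] {G : SimpleGraph X}
    [DecidableRel G.Adj] (hG : G.Connected) : 1 ≤ G.maxDegree := by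
  obtain ⟨x⟩ := (inferInstance : Nonempty X)
  obtain ⟨y, hy⟩ := hG.preconnected.exists_adj_of_nontrivial x
  exact ((G.degree_pos_iff_exists_adj x).2 ⟨y, hy⟩).trans_le (G.degree_le_maxDegree x)

end InformedMH

open InformedMH in
theorem theorem2 {X : Type*} [Fintype X] [DecidableEq X] [Nontrivial X]
    (G : SimpleGraph X) [DecidableRel G.Adj] (hG : G.Connected)
    (π : X → ℝ) (hpos : ∀ x, 0 < π x) (hsum : ∑ x, π x = 1)
    (xstar : X) (hxstar : ∀ x, π x ≤ π xstar)
    (hR : (G.maxDegree : ℝ) ^ 2 < InformedMH.tailRatio G π xstar)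
    (L : ℝ) (hML : (G.maxDegree : ℝ) ^ 2 < L) (hLR : L ≤ InformedMH.tailRatio G π xstar) :
    0 < InformedMH.spectralGap (InformedMH.lazyInformed G π G.maxDegree L) ∧
    (InformedMH.spectralGap (InformedMH.lazyInformed G π G.maxDegree L))⁻¹ ≤
      2 * InformedMH.mixConst (L / (G.maxDegree : ℝ) ^ 2) ∧
    ∀ ε : ℝ, 0 < ε → ε < 1 / 2 →
      ∃ T : ℕ, InformedMH.mixingTime (InformedMH.lazyInformed G π G.maxDegree L) π ε = (T : ℕ∞) ∧
        (T : ℝ) ≤ 2 * InformedMH.mixConst (L / (G.maxDegree : ℝ) ^ 2) *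
          Real.log (1 / (ε * ⨅ x, π x)) := by
  set M : ℝ := (G.maxDegree : ℝ)
  have hM : 1 ≤ M := Nat.one_le_cast.2 (one_le_maxDegree hG)
  have hM2 : 0 < M ^ 2 := by positivity
  have hL : 0 < L := hM2.trans hML
  have hlL : M ≤ L := by nlinarith
  have hh : ∀ u, 0 < clip M L u := fun u => by linarith [le_clip hlL u]
  have hρ : 1 < L / M ^ 2 := (one_lt_div hM2).2 hML
  obtain ⟨hθ, hθ1, hC⟩ := mixConst_bounds hρ
  set θ : ℝ := (L / M ^ 2) ^ (-(1 / 2) : ℝ) with hθdef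
  set C : ℝ := 2 * mixConst (L / M ^ 2) with hCdef
  have hC0 : 0 < C := by linarith
  have hθ2 : M ^ 2 / L ≤ θ ^ 2 := by
    rw [hθdef, ← Real.rpow_mul_natCast (by positivity)]
    norm_num [Real.rpow_neg_one]
  have hCinv : C⁻¹ = (1 - θ) ^ 3 / 8 := by
    rw [hCdef, mixConst, ← hθdef]
    have : 1 - θ ≠ 0 := by linarith
    field_simp
    norm_num
  have hup : ∀ x, x ≠ xstar → ∃ y, G.Adj x y ∧ L ≤ π y / π x :=
    fun x hx => exists_adj_le_ratio hG hLR hx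
  have hrev := lazyVersion_reversible (transition_reversible (G := G) hpos hh)
  have hrow : ∀ x, ∑ y, lazyInformed G π M L x y = 1 := sum_lazyVersion sum_transition
  have hpsd : ∀ f, 0 ≤ weightedInner π f ((lazyInformed G π M L).mulVec f) :=
    weightedInner_lazyVersion_nonneg hpos (transition_nonneg hpos hh)
      (transition_reversible hpos hh) sum_transition
  have hgap : ∀ f, ∑ x, π x * f x = 0 → weightedInner π f ((lazyInformed G π M L).mulVec f) ≤
      (1 - C⁻¹) * weightedInner π f f := by
    intro f hf
    have h := weightedInner_self_le_transition hpos hsum hM hML.le le_rfl hup hθ hθ1 hθ2 hf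
    rw [lazyInformed, weightedInner_lazyVersion, hCinv]
    -- The comparison yields the lazy constant `(1 - θ) ^ 2 / 8`; the stated cube is weaker.
    have h2 : (1 - θ) ^ 3 ≤ (1 - θ) ^ 2 :=
      pow_le_pow_of_le_one (by linarith) (by linarith) (by norm_num)
    nlinarith [mul_le_mul_of_nonneg_right h2 (weightedInner_self_nonneg hpos f)]
  have hg := one_sub_le_spectralGap hpos hrev hpsd hgap
  rw [sub_sub_cancel] at hg
  have hCi : 0 < C⁻¹ := inv_pos.2 hC0
  refine ⟨hCi.trans_le hg, (inv_le_comm₀ (hCi.trans_le hg) hC0).2 hg, fun ε hε hε2 => ?_⟩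
  obtain ⟨T, hT, hTle⟩ := exists_mixingTime_eq_of_tvDist_le (P := lazyInformed G π M L)
    (tvDist_pow_floor_le hpos hsum hC hrev hrow hpsd hgap hε)
  refine ⟨T, hT, le_trans (by exact_mod_cast hTle) (Nat.floor_le (mul_nonneg hC0.le ?_))⟩
  have hm1 : ⨅ x, π x ≤ 1 := (ciInf_le (Set.finite_range π).bddBelow xstar).trans
    (hsum ▸ Finset.single_le_sum (fun y _ => (hpos y).le) (Finset.mem_univ xstar))
  have hm0 : 0 < ⨅ x, π x := by
    obtain ⟨y, hy⟩ := exists_eq_ciInf_of_finite (f := π)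
    rw [← hy]
    exact hpos y
  exact Real.log_nonneg ((one_le_div (by positivity)).2 (by nlinarith))
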